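/- Let $m,k\ge 1$ be integers and let $b(z)=\sum_{n=-m}^{k}b_nz^n$ be a Laurent polynomial with complex coefficients and $b_{-m}b_k\neq 0$. Let $T_b$ be the Toeplitz operator $T_bf=P_+(bf)$ on the Hardy space $H^2(\mathbb T)$, where $P_+$ is the orthogonal projection of $L^2(\mathbb T)$ onto $H^2(\mathbb T)$; write $\sigma(T_b)$ and $\rho(T_b)$ for its spectrum and resolvent set, and put $\Omega_\varepsilon=\{w\in\rho(T_b):|w-w_0|<\varepsilon\}$. For $w\in\mathbb C$ let $Z_{in}(w)$, $Z_{un}(w)$, $Z_{ext}(w)$ be the families of roots, counted with multiplicity, of the polynomial $z\mapsto z^m(b(z)-w)$ with $|z|<1$, $|z|=1$, $|z|>1$ respectively, and let $|\cdot|$ denote the number of elements counted with multiplicity. Let $t_0\in\mathbb T$ be such that $w_0=b(t_0)$ belongs to the boundary $\partial\sigma(T_b)$. Suppose that at least one of the following holds: (i) $|Z_{un}(w_0)|=1$; (ii) $|Z_{in}(w_0)|=m$; (iii) $|Z_{ext}(w_0)|=k$. Then: (a) $b$ is locally regular at $w_0$, i.e. there are $\varepsilon>0$ and $\delta>0$ such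 that either $1-|z|\ge\delta$ for all $w\in\Omega_\varepsilon$ and all $z\in Z_{in}(w)$, or $|z|-1\ge\delta$ for all $w\in\Omega_\varepsilon$ and all $z\in Z_{ext}(w)$; (b) $T_b$ has local linear resolvent growth at $w_0$, i.e. there is a constant $C>0$ such that for all sufficiently small $\varepsilon>0$ $$\|(T_b-w)^{-1}\|\le\frac{C}{\operatorname{dist}(w,\sigma(T_b))},\qquad w\in\Omega_\varepsilon .$$ In particular, (a) and (b) hold whenever $w_0$ is neither a self-intersection point of $b(\mathbb T)$ (that is, $t_0$ is the only $t\in\mathbb T$ with $b(t)=w_0$) nor a cusp (that is, $b'(t_0)\neq0$). -/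

import Mathlib

open MeasureTheory
open scoped ENNReal LaurentPolynomial

namespace BandedToeplitz

noncomputable section

/-! ### The Hilbert spaces and the Toeplitz operator -/

/-- Normalised Lebesgue (Haar) measure on the circle; the point `x : ℝ / ℤ` stands for
`t = exp (2 π i x)`, which is `AddCircle.toCircle x`. -/
abbrev circleMeasure : Measure UnitAddCircle := AddCircle.haarAddCircle

/-- The Hilbert space `L²(𝕋)`. -/
abbrev L2 : Type := Lp ℂ 2 circleMeasure

/-- The Hardy space `H²(𝕋)`: functions in `L²(𝕋)` whose Fourier coefficients of negative index
vanish. -/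
def H2 : Submodule ℂ L2 where
  carrier := {f | ∀ n : ℤ, n < 0 → fourierCoeff f n = 0}
  zero_mem' := fun n _ => by
    rw [← fourierBasis_repr]; simp
  add_mem' := fun {f g} hf hg n hn => by
    have h1 := hf n hn
    have h2 := hg n hn
    rw [← fourierBasis_repr] at h1 h2 ⊢
    simp [h1, h2]
  smul_mem' := fun c f hf n hn => by
    have h1 := hf n hn
    rw [← fourierBasis_repr] at h1 ⊢
    simp [h1]

theorem mem_H2 (f : L2) : f ∈ H2 ↔ ∀ n : ℤ, n < 0 → fourierCoeff f n = 0 := Iff.rfl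

theorem isClosed_H2 : IsClosed (H2 : Set L2) := by
  have h : (H2 : Set L2) =
      ⋂ n : ℤ, ⋂ _ : n < 0, {f : L2 | inner ℂ (fourierLp (T := 1) 2 n) f = 0} := by
    ext f
    simp only [SetLike.mem_coe, mem_H2, Set.mem_iInter, Set.mem_ofPred_eq]
    refine forall_congr' fun n => forall_congr' fun _ => ?_
    rw [← fourierBasis_repr, HilbertBasis.repr_apply_apply, coe_fourierBasis]
  rw [h]
  refine isClosed_iInter fun n => isClosed_iInter fun _ => ?_
  exact isClosed_eq (by fun_prop) continuous_const

instance : CompleteSpace H2 := isClosed_H2.completeSpace_coe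

/-- Multiplication by a continuous function, as a bounded operator on `L²(𝕋)`. -/
def mulOp (φ : C(UnitAddCircle, ℂ)) : L2 →L[ℂ] L2 :=
  (ContinuousLinearMap.mul ℂ ℂ).holderL circleMeasure ∞ 2 2
    (ContinuousMap.toLp ∞ circleMeasure ℂ φ)

theorem coeFn_mulOp (φ : C(UnitAddCircle, ℂ)) (f : L2) :
    mulOp φ f =ᵐ[circleMeasure] fun x => φ x * f x := by
  have h1 := (ContinuousLinearMap.mul ℂ ℂ).coeFn_holder (r := 2)
    (ContinuousMap.toLp ∞ circleMeasure ℂ φ) f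
  have h2 := ContinuousMap.coeFn_toLp (p := ∞) (𝕜 := ℂ) circleMeasure φ
  filter_upwards [h1, h2] with x hx1 hx2
  refine Eq.trans hx1 ?_
  rw [hx2]
  rfl

/-- The value `b(z) = ∑ b_n z^n` of a Laurent polynomial at `z ≠ 0`. -/
def value (b : ℂ[T;T⁻¹]) (z : ℂ) : ℂ := b.coeff.sum fun n a => a * z ^ n

/-- The restriction of a Laurent polynomial to the unit circle. -/
def symbol (b : ℂ[T;T⁻¹]) : C(UnitAddCircle, ℂ) where
  toFun x := value b (AddCircle.toCircle x : ℂ)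
  continuous_toFun := by
    unfold value Finsupp.sum
    refine continuous_finsetSum _ fun n _ => continuous_const.mul ?_
    have h : Continuous fun x : UnitAddCircle => (AddCircle.toCircle x : ℂ) :=
      continuous_subtype_val.comp AddCircle.continuous_toCircle
    exact h.zpow₀ n fun x => Or.inl (Circle.coe_ne_zero _)

/-- The Toeplitz operator `T_b f = P₊ (b f)` on `H²(𝕋)`, where `P₊` is the orthogonal projection of
`L²(𝕋)` onto `H²(𝕋)`. -/
def toeplitz (b : ℂ[T;T⁻¹]) : H2 →L[ℂ] H2 :=
  H2.orthogonalProjectionOnto ∘L mulOp (symbol b) ∘L H2.subtypeL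

/-! ### Zeros of `z^m (b(z) - w)` -/

/-- `b(z) = b_{-m} z^{-m} + ⋯ + b_k z^k` with `b_{-m} ≠ 0` and `b_k ≠ 0`. -/
structure HasBand (b : ℂ[T;T⁻¹]) (m k : ℕ) : Prop where
  support_subset : b.coeff.support ⊆ Finset.Icc (-(m : ℤ)) (k : ℤ)
  coeff_neg_ne_zero : b.coeff (-(m : ℤ)) ≠ 0
  coeff_pos_ne_zero : b.coeff (k : ℤ) ≠ 0

/-- The polynomial `P(z, w) = z^m (b(z) - w)` in the variable `z`, for `b` with band `(m, k)`. -/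
def charPoly (b : ℂ[T;T⁻¹]) (m k : ℕ) (w : ℂ) : Polynomial ℂ :=
  (∑ j ∈ Finset.range (m + k + 1),
      Polynomial.C (b.coeff ((j : ℤ) - (m : ℤ))) * Polynomial.X ^ j)
    - Polynomial.C w * Polynomial.X ^ m

theorem eval_charPoly {b : ℂ[T;T⁻¹]} {m k : ℕ} (hb : HasBand b m k) (w : ℂ) {z : ℂ} (hz : z ≠ 0) :
    (charPoly b m k w).eval z = z ^ m * (value b z - w) := by
  have h1 : value b z = ∑ n ∈ Finset.Icc (-(m : ℤ)) (k : ℤ), b.coeff n * z ^ n :=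
    Finsupp.sum_of_support_subset _ hb.support_subset _ (by simp)
  have h2 : ∑ n ∈ Finset.Icc (-(m : ℤ)) (k : ℤ), b.coeff n * z ^ n
      = ∑ j ∈ Finset.range (m + k + 1), b.coeff ((j : ℤ) - m) * z ^ ((j : ℤ) - m) := by
    symm
    refine Finset.sum_bij (fun j _ => (j : ℤ) - m) ?_ ?_ ?_ ?_
    · intro j hj
      simp only [Finset.mem_range, Finset.mem_Icc] at *
      omega
    · intro i _ j _ hij
      omega
    · intro n hn
      simp only [Finset.mem_Icc] at hn
      refine ⟨(n + m).toNat, ?_, ?_⟩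
      · simp only [Finset.mem_range]; omega
      · omega
    · intro j _; rfl
  rw [h1, h2, charPoly]
  simp only [Polynomial.eval_sub, Polynomial.eval_finsetSum, Polynomial.eval_mul,
    Polynomial.eval_C, Polynomial.eval_pow, Polynomial.eval_X, mul_sub, Finset.mul_sum]
  congr 1
  · refine Finset.sum_congr rfl fun j _ => ?_
    rw [zpow_sub₀ hz, zpow_natCast, zpow_natCast]
    field_simp
  · ring

/-- The divisor `Z(w)`: the roots of `P(·, w)` with multiplicity. -/
def zeros (b : ℂ[T;T⁻¹]) (m k : ℕ) (w : ℂ) : Multiset ℂ := (charPoly b m k w).roots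

open Classical in
/-- `Z_in(w)`: the roots in the open unit disk. -/
def zerosIn (b : ℂ[T;T⁻¹]) (m k : ℕ) (w : ℂ) : Multiset ℂ :=
  (zeros b m k w).filter fun z => ‖z‖ < 1

open Classical in
/-- `Z_un(w)`: the roots on the unit circle. -/
def zerosUn (b : ℂ[T;T⁻¹]) (m k : ℕ) (w : ℂ) : Multiset ℂ :=
  (zeros b m k w).filter fun z => ‖z‖ = 1

open Classical in
/-- `Z_ext(w)`: the roots outside the closed unit disk. -/
def zerosExt (b : ℂ[T;T⁻¹]) (m k : ℕ) (w : ℂ) : Multiset ℂ :=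
  (zeros b m k w).filter fun z => 1 < ‖z‖

/-! ### Local regularity and local linear resolvent growth -/

/-- `Ω(b, w₀, ε) = B(w₀, ε) ∩ ρ(T_b)`. -/
def localRegion (b : ℂ[T;T⁻¹]) (w₀ : ℂ) (ε : ℝ) : Set ℂ :=
  Metric.ball w₀ ε ∩ resolventSet ℂ (toeplitz b)

/-- Local regularity at `w₀`: for some neighbourhood of `w₀`, one of the families `Z_in(w)`,
`Z_ext(w)` stays at a distance at least `δ > 0` from the unit circle for all `w ∈ Ω`. -/
def LocallyRegularAt (b : ℂ[T;T⁻¹]) (m k : ℕ) (w₀ : ℂ) : Prop :=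
  ∃ ε > 0, ∃ δ > 0,
    (∀ w ∈ localRegion b w₀ ε, ∀ z ∈ zerosIn b m k w, δ ≤ 1 - ‖z‖) ∨
    (∀ w ∈ localRegion b w₀ ε, ∀ z ∈ zerosExt b m k w, δ ≤ ‖z‖ - 1)

/-- Local linear resolvent growth at `w₀`. For `w` in the resolvent set, `Ring.inverse` is the
genuine inverse of `T_b - w`. -/
def LLRG (b : ℂ[T;T⁻¹]) (w₀ : ℂ) : Prop :=
  ∃ C > 0, ∃ ε₀ > 0, ∀ ε : ℝ, 0 < ε → ε ≤ ε₀ → ∀ w ∈ localRegion b w₀ ε,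
    ‖Ring.inverse (toeplitz b - algebraMap ℂ (H2 →L[ℂ] H2) w)‖
      ≤ C / Metric.infDist w (spectrum ℂ (toeplitz b))

end

end BandedToeplitz

namespace BandedToeplitz

noncomputable section

/-! ### Multiplication operators -/

/-! The argument combines Wiener–Hopf factorization with root counting. Values of `b` on the circle
lie in the spectrum (`value_mem_spectrum`), so for `w` in the resolvent set no root is unimodular
and `b - w = φ z^(|Z_in| - m) χ`, with `φ` built from `Z_in` and `χ` from `Z_ext`
(`exists_symbol_sub_eq_factor`). The outer factors give invertible Toeplitz operators, so
invertibility of `T_b - w` forces `|Z_in(w)| = m` and `|Z_ext(w)| = k`.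

Then `(T_b - w)⁻¹ = T_{χ⁻¹} T_{φ⁻¹}`. Since `χ⁻¹ = φ (b - w)⁻¹`, its norm is at most `‖φ‖ ‖φ⁻¹‖ /
dist(w, σ)`, and symmetrically with `χ`. Controlling one family of roots therefore suffices, and
local regularity implies linear growth (`LocallyRegularAt.llrg`).

Regularity comes from lower semicontinuity of the number of roots in an open set. If `|Z_in(w₀)|` is
already `m`, no further root can enter the disk for nearby resolvent points, so the inner roots stay
away from the circle; likewise outside. If exactly one root is unimodular, semicontinuity at
resolvent points near `w₀` bounds the two counts by `m` and `k`; their sum is `m + k - 1`, so one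
bound is attained. -/

theorem mulOp_mul (φ ψ : C(UnitAddCircle, ℂ)) (f : L2) :
    mulOp (φ * ψ) f = mulOp φ (mulOp ψ f) := by
  refine Lp.ext ?_
  filter_upwards [coeFn_mulOp (φ * ψ) f, coeFn_mulOp φ (mulOp ψ f), coeFn_mulOp ψ f]
    with x h1 h2 h3
  rw [h1, h2, h3, ContinuousMap.mul_apply, mul_assoc]

theorem mulOp_one (f : L2) : mulOp 1 f = f := by
  refine Lp.ext ?_
  filter_upwards [coeFn_mulOp 1 f] with x h1
  rw [h1, ContinuousMap.one_apply, one_mul]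

theorem mulOp_add (φ ψ : C(UnitAddCircle, ℂ)) : mulOp (φ + ψ) = mulOp φ + mulOp ψ := by
  simp [mulOp]

theorem mulOp_smul (c : ℂ) (φ : C(UnitAddCircle, ℂ)) : mulOp (c • φ) = c • mulOp φ := by
  simp [mulOp]

theorem norm_mulOp_apply_le (φ : C(UnitAddCircle, ℂ)) (f : L2) :
    ‖mulOp φ f‖ ≤ ‖φ‖ * ‖f‖ := by
  refine Lp.norm_le_mul_norm_of_ae_le_mul ?_
  filter_upwards [coeFn_mulOp φ f] with x h1
  rw [h1, norm_mul]
  gcongr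
  exact φ.norm_coe_le_norm x

/-- The map `φ ↦ φ f`, as a linear map. -/
def mulOpLinear (f : L2) : C(UnitAddCircle, ℂ) →ₗ[ℂ] L2 where
  toFun φ := mulOp φ f
  map_add' φ ψ := by rw [mulOp_add]; rfl
  map_smul' c φ := by rw [mulOp_smul]; rfl

theorem continuous_mulOp_apply (f : L2) : Continuous fun φ => mulOp φ f :=
  ((mulOpLinear f).mkContinuous ‖f‖ fun φ => by
    rw [mul_comm]; exact norm_mulOp_apply_le φ f).continuous

theorem mulOp_sub (φ ψ : C(UnitAddCircle, ℂ)) (f : L2) :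
    mulOp (φ - ψ) f = mulOp φ f - mulOp ψ f :=
  (mulOpLinear f).map_sub φ ψ

theorem mulOp_fourierLp (i j : ℤ) :
    mulOp (fourier i) (fourierLp 2 j) = fourierLp 2 (i + j) := by
  refine Lp.ext ?_
  filter_upwards [coeFn_mulOp (fourier i) (fourierLp 2 j), coeFn_fourierLp (T := 1) 2 j,
    coeFn_fourierLp (T := 1) 2 (i + j)] with x h1 h2 h3
  rw [h1, h2, h3, fourier_add]

theorem fourierCoeff_mulOp (i n : ℤ) (f : L2) :
    fourierCoeff (mulOp (fourier i) f) n = fourierCoeff f (n - i) := by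
  unfold fourierCoeff
  refine integral_congr_ae ?_
  filter_upwards [coeFn_mulOp (fourier i) f] with x h1
  rw [h1, smul_eq_mul, smul_eq_mul, ← mul_assoc, ← fourier_add]
  congr 3
  ring

theorem inner_mulOp_fourier (i : ℤ) (f g : L2) :
    inner ℂ f (mulOp (fourier i) g) = inner ℂ (mulOp (fourier (-i)) f) g := by
  rw [L2.inner_def, L2.inner_def]
  refine integral_congr_ae ?_
  filter_upwards [coeFn_mulOp (fourier i) g, coeFn_mulOp (fourier (-i)) f] with x h1 h2
  rw [h1, h2, RCLike.inner_apply, RCLike.inner_apply, map_mul, fourier_neg, Complex.conj_conj]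
  ring

/-! ### Multipliers of a closed subspace -/

/-- The algebra of continuous functions whose multiplication operator leaves `V` invariant. -/
def multiplier (V : Submodule ℂ L2) : Subalgebra ℂ C(UnitAddCircle, ℂ) where
  carrier := {φ | ∀ f ∈ V, mulOp φ f ∈ V}
  mul_mem' := fun {φ ψ} hφ hψ f hf => by
    rw [mulOp_mul]; exact hφ _ (hψ _ hf)
  add_mem' := fun {φ ψ} hφ hψ f hf => by
    rw [mulOp_add]; exact V.add_mem (hφ _ hf) (hψ _ hf)
  algebraMap_mem' := fun c f hf => by
    rw [Algebra.algebraMap_eq_smul_one, mulOp_smul, smul_apply, mulOp_one]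
    exact V.smul_mem c hf

theorem isClosed_multiplier {V : Submodule ℂ L2} (hV : IsClosed (V : Set L2)) :
    IsClosed (multiplier V : Set C(UnitAddCircle, ℂ)) := by
  have h : (multiplier V : Set C(UnitAddCircle, ℂ)) =
      ⋂ f : L2, ⋂ _ : f ∈ V, (fun φ => mulOp φ f) ⁻¹' (V : Set L2) := by
    ext φ
    simp [multiplier]
  rw [h]
  exact isClosed_iInter fun f => isClosed_iInter fun _ => hV.preimage (continuous_mulOp_apply f)

/-- Neumann series: its partial sums lie in the multiplier algebra, which is closed because `V` is.
-/
theorem exists_inverse_one_sub {V : Submodule ℂ L2} (hV : IsClosed (V : Set L2))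
    {φ : C(UnitAddCircle, ℂ)} (hφ : φ ∈ multiplier V) {s : ℝ} (hs : s < 1) (hφs : ‖φ‖ ≤ s) :
    ∃ ψ ∈ multiplier V, (1 - φ) * ψ = 1 ∧ ‖ψ‖ ≤ (1 - s)⁻¹ := by
  have h1 : ‖φ‖ < 1 := hφs.trans_lt hs
  refine ⟨∑' n, φ ^ n, ?_, mul_neg_geom_series φ h1, ?_⟩
  · refine (isClosed_multiplier hV).mem_of_tendsto
      (summable_geometric_of_norm_lt_one h1).hasSum (Filter.Eventually.of_forall fun t => ?_)
    exact (multiplier V).sum_mem fun n _ => (multiplier V).pow_mem hφ n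
  · refine (tsum_geometric_le_of_norm_lt_one φ h1).trans ?_
    rw [norm_one, sub_self, zero_add]
    have : 0 < 1 - s := by linarith
    gcongr

/-- The product of the factors `1 - ζ φ`, where `ζ` runs through `S`. -/
def factor (φ : C(UnitAddCircle, ℂ)) (S : Multiset ℂ) : C(UnitAddCircle, ℂ) :=
  (S.map fun ζ => 1 - ζ • φ).prod

/-- Keeping `V` general serves both `H2` with `φ = z` and `H2ᗮ` with `φ = z⁻¹`. The bounds depend
only on `s` and the number of roots, which later makes them uniform in `w`. -/
theorem exists_inverse_factor {V : Submodule ℂ L2} (hV : IsClosed (V : Set L2))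
    {φ : C(UnitAddCircle, ℂ)} (hφ : φ ∈ multiplier V) (hφ1 : ‖φ‖ ≤ 1) {s : ℝ} (hs : s < 1)
    (S : Multiset ℂ) (hS : ∀ ζ ∈ S, ‖ζ‖ ≤ s) :
    factor φ S ∈ multiplier V ∧ ‖factor φ S‖ ≤ 2 ^ Multiset.card S ∧
    ∃ ψ ∈ multiplier V, factor φ S * ψ = 1 ∧ ‖ψ‖ ≤ (1 - s)⁻¹ ^ Multiset.card S := by
  induction S using Multiset.induction_on with
  | empty =>
    refine ⟨(multiplier V).one_mem, by simp [factor], 1, (multiplier V).one_mem, ?_, by simp⟩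
    simp [factor]
  | cons ζ S ih =>
    obtain ⟨h1, h2, ψ, h3, h4, h5⟩ := ih fun z hz => hS z (Multiset.mem_cons_of_mem hz)
    have hζ := hS ζ (Multiset.mem_cons_self ζ S)
    have hm := (multiplier V).smul_mem hφ ζ
    have hn : ‖ζ • φ‖ ≤ s := by
      rw [norm_smul]
      nlinarith [norm_nonneg ζ, norm_nonneg φ]
    obtain ⟨χ, h6, h7, h8⟩ := exists_inverse_one_sub hV hm hs hn
    have hf : factor φ (ζ ::ₘ S) = (1 - ζ • φ) * factor φ S := by simp [factor]
    have h9 : ‖1 - ζ • φ‖ ≤ 2 := by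
      refine (norm_sub_le _ _).trans ?_
      rw [norm_one]; linarith
    rw [hf, Multiset.card_cons, pow_succ', pow_succ']
    refine ⟨(multiplier V).mul_mem ((multiplier V).sub_mem (multiplier V).one_mem hm) h1,
      (norm_mul_le _ _).trans (mul_le_mul h9 h2 (norm_nonneg _) zero_le_two),
      χ * ψ, (multiplier V).mul_mem h6 h3, ?_,
      (norm_mul_le _ _).trans (mul_le_mul h8 h5 (norm_nonneg _) ((norm_nonneg _).trans h8))⟩
    rw [mul_mul_mul_comm, h7, h4, one_mul]

theorem fourier_mem_multiplier_H2 (n : ℕ) : fourier (n : ℤ) ∈ multiplier H2 := by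
  intro f hf j hj
  rw [fourierCoeff_mulOp]
  exact hf _ (by omega)

/-- Multiplication by `z^(-n)` is the adjoint of multiplication by `z^n`, which preserves `H2`. -/
theorem fourier_neg_mem_multiplier_orthogonal (n : ℕ) :
    fourier (-(n : ℤ)) ∈ multiplier H2ᗮ := by
  intro f hf
  rw [Submodule.mem_orthogonal] at hf ⊢
  intro g hg
  rw [inner_mulOp_fourier, neg_neg]
  exact hf _ (fourier_mem_multiplier_H2 n g hg)

/-! ### Toeplitz operators with continuous symbols -/

/-- The Toeplitz operator on `H²(𝕋)` with continuous symbol `φ`. -/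
def toeplitzOp (φ : C(UnitAddCircle, ℂ)) : H2 →L[ℂ] H2 :=
  H2.orthogonalProjectionOnto ∘L mulOp φ ∘L H2.subtypeL

theorem toeplitzOp_apply (φ : C(UnitAddCircle, ℂ)) (f : H2) :
    toeplitzOp φ f = H2.orthogonalProjectionOnto (mulOp φ f) := rfl

theorem norm_toeplitzOp_apply_le (φ : C(UnitAddCircle, ℂ)) (f : H2) :
    ‖toeplitzOp φ f‖ ≤ ‖mulOp φ f‖ :=
  H2.norm_orthogonalProjectionOnto_apply_le _

theorem norm_toeplitzOp_le (φ : C(UnitAddCircle, ℂ)) : ‖toeplitzOp φ‖ ≤ ‖φ‖ :=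
  (toeplitzOp φ).opNorm_le_bound (norm_nonneg _) fun f =>
    (norm_toeplitzOp_apply_le φ f).trans (norm_mulOp_apply_le φ f)

theorem toeplitzOp_one : toeplitzOp 1 = 1 := by
  ext1 f
  rw [toeplitzOp_apply, mulOp_one, H2.orthogonalProjectionOnto_mem_subspace_eq_self]
  rfl

theorem toeplitzOp_sub_algebraMap (φ : C(UnitAddCircle, ℂ)) (w : ℂ) :
    toeplitzOp (φ - algebraMap ℂ _ w) = toeplitzOp φ - algebraMap ℂ _ w := by
  ext1 f
  rw [toeplitzOp_apply, mulOp_sub, map_sub, Algebra.algebraMap_eq_smul_one, mulOp_smul,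
    smul_apply, mulOp_one, map_smul,
    H2.orthogonalProjectionOnto_mem_subspace_eq_self, Algebra.algebraMap_eq_smul_one]
  rfl

/-- The inner projection does nothing, because `φ f` is already in `H2`. -/
theorem toeplitzOp_mul_of_right {φ : C(UnitAddCircle, ℂ)} (hφ : φ ∈ multiplier H2)
    (ψ : C(UnitAddCircle, ℂ)) : toeplitzOp (ψ * φ) = toeplitzOp ψ * toeplitzOp φ := by
  ext1 f
  have h : (toeplitzOp φ f : L2) = mulOp φ f :=
    congrArg Subtype.val (H2.orthogonalProjectionOnto_mem_subspace_eq_self ⟨_, hφ f f.2⟩)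
  rw [mul_apply_eq_comp, toeplitzOp_apply, toeplitzOp_apply ψ, h, mulOp_mul]

/-- What the inner projection discards lies in `H2ᗮ`; `ψ` keeps it there and the outer projection
kills it. -/
theorem toeplitzOp_mul_of_left {ψ : C(UnitAddCircle, ℂ)} (hψ : ψ ∈ multiplier H2ᗮ)
    (φ : C(UnitAddCircle, ℂ)) : toeplitzOp (ψ * φ) = toeplitzOp ψ * toeplitzOp φ := by
  ext1 f
  rw [mul_apply_eq_comp, toeplitzOp_apply, toeplitzOp_apply ψ, mulOp_mul,
    ← sub_eq_zero, ← map_sub, ← map_sub, H2.orthogonalProjectionOnto_eq_zero_iff]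
  exact hψ _ (H2.sub_starProjection_mem_orthogonal (mulOp φ f))

theorem fourierLp_mem_H2 (n : ℕ) : fourierLp 2 (n : ℤ) ∈ H2 := by
  intro j hj
  rw [← fourierBasis_repr, ← coe_fourierBasis, HilbertBasis.repr_self, lp.single_apply]
  simp [Pi.single_apply]
  omega

theorem fourierLp_neg_mem_orthogonal {n : ℤ} (hn : n < 0) : fourierLp 2 n ∈ H2ᗮ := by
  rw [Submodule.mem_orthogonal']
  intro f hf
  rw [← coe_fourierBasis, ← HilbertBasis.repr_apply_apply, fourierBasis_repr]
  exact hf n hn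

theorem fourierLp_ne_zero (n : ℤ) : (fourierLp 2 n : L2) ≠ 0 :=
  (orthonormal_fourier (T := 1)).ne_zero n

/-- `T_{z^n}` is invertible only for `n = 0`. -/
theorem eq_zero_of_isUnit_toeplitzOp_fourier {n : ℤ} (h : IsUnit (toeplitzOp (fourier n))) :
    n = 0 := by
  obtain ⟨⟨T, S, h1, h2⟩, rfl : T = _⟩ := h
  set e : H2 := ⟨fourierLp 2 ((0 : ℕ) : ℤ), fourierLp_mem_H2 0⟩
  have he : e ≠ 0 := fun h => fourierLp_ne_zero _ (congrArg Subtype.val h)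
  rcases lt_trichotomy n 0 with hn | hn | hn
  · exfalso
    -- For `n < 0` injectivity fails: constants are in the kernel.
    have h3 : toeplitzOp (fourier n) e = 0 := by
      rw [toeplitzOp_apply, mulOp_fourierLp, H2.orthogonalProjectionOnto_eq_zero_iff]
      exact fourierLp_neg_mem_orthogonal (by simpa using hn)
    have h4 : (S * toeplitzOp (fourier n)) e = e := by rw [h2]; rfl
    rw [mul_apply_eq_comp, h3, map_zero] at h4
    exact he h4.symm
  · exact hn
  · exfalso
    lift n to ℕ using hn.le
    -- For `n > 0` surjectivity fails: every function in the range has zero constant coefficient.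
    have h4 : (toeplitzOp (fourier n) * S) e = e := by rw [h1]; rfl
    have h5 : mulOp (fourier n) (S e) = e := by
      exact (congrArg Subtype.val (H2.orthogonalProjectionOnto_mem_subspace_eq_self
        ⟨_, fourier_mem_multiplier_H2 n (S e) (S e).2⟩)).symm.trans (congrArg Subtype.val h4)
    have h6 : fourierCoeff (e : L2) 0 = 0 := by
      rw [← h5, fourierCoeff_mulOp]
      exact (S e).2 _ (by omega)
    rw [← fourierBasis_repr, HilbertBasis.repr_apply_apply, coe_fourierBasis] at h6
    exact fourierLp_ne_zero 0 (inner_self_eq_zero.1 h6)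

/-! ### Lower semicontinuity of the number of roots in an open set -/

theorem exists_roots_eq_map {p : Polynomial ℂ} {N : ℕ} (hN : p.natDegree = N) :
    ∃ r : Fin N → ℂ, p.roots = Finset.univ.val.map r := by
  have hc : Multiset.card p.roots = N := by
    rw [← hN]; exact IsAlgClosed.card_roots_eq_natDegree
  obtain ⟨l, hl⟩ := Quot.exists_rep p.roots
  have hl' : p.roots = (l : Multiset ℂ) := hl.symm
  rw [hl'] at hc ⊢
  have hc' : l.length = N := by simpa using hc
  subst hc'
  refine ⟨l.get, ?_⟩
  rw [Fin.univ_val_map, List.ofFn_get]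

-- With constant degree and leading coefficient and a local bound on the roots, no root escapes to
-- infinity. If the inequality failed arbitrarily near `w₀`, the ordered root tuples would converge
-- along an ultrafilter on the failing points; the limit lists the roots of `P w₀`, and those in the
-- open set `U` are limits of roots in `U`.
open Classical in
theorem eventually_card_filter_roots_le {P : ℂ → Polynomial ℂ} {w₀ : ℂ} {N : ℕ} {c : ℂ}
    (hc : c ≠ 0) (hN : ∀ w, (P w).natDegree = N) (hlead : ∀ w, (P w).leadingCoeff = c)
    (hcont : ∀ z, ContinuousAt (fun w => (P w).eval z) w₀) {R : ℝ}
    (hR : ∀ᶠ w in nhds w₀, ∀ z ∈ (P w).roots, ‖z‖ ≤ R) {U : Set ℂ} (hU : IsOpen U) :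
    ∀ᶠ w in nhds w₀, Multiset.card ((P w₀).roots.filter (· ∈ U)) ≤
      Multiset.card ((P w).roots.filter (· ∈ U)) := by
  choose r hr using fun w => exists_roots_eq_map (hN w)
  have heval : ∀ w z, (P w).eval z = c * ∏ i, (z - r w i) := fun w z => by
    rw [(IsAlgClosed.splits (P w)).eval_eq_prod_roots, hlead, hr, Multiset.map_map]
    rfl
  have hcard : ∀ s : Fin N → ℂ, Multiset.card ((Finset.univ.val.map s).filter (· ∈ U)) =
      (Finset.univ.filter fun i => s i ∈ U).card := fun s => by
    rw [Multiset.filter_map, Multiset.card_map]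
    rfl
  by_contra hcon
  have : (nhds w₀ ⊓ Filter.principal {w | ¬ Multiset.card ((P w₀).roots.filter (· ∈ U)) ≤
      Multiset.card ((P w).roots.filter (· ∈ U))}).NeBot :=
    Filter.frequently_mem_iff_neBot.1 (Filter.not_eventually.1 hcon)
  obtain ⟨F, hF⟩ := Ultrafilter.exists_le (nhds w₀ ⊓ Filter.principal {w | ¬ Multiset.card
    ((P w₀).roots.filter (· ∈ U)) ≤ Multiset.card ((P w).roots.filter (· ∈ U))})
  have hFn : (F : Filter ℂ) ≤ nhds w₀ := hF.trans inf_le_left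
  have hFs : ∀ᶠ w in (F : Filter ℂ), ¬ Multiset.card ((P w₀).roots.filter (· ∈ U)) ≤
      Multiset.card ((P w).roots.filter (· ∈ U)) :=
    Filter.le_principal_iff.1 (hF.trans inf_le_right)
  obtain ⟨q, -, hq⟩ := (isCompact_univ_pi fun _ : Fin N =>
    isCompact_closedBall (0 : ℂ) R).ultrafilter_le_nhds (F.map r) (by
      rw [Filter.le_principal_iff]
      change ∀ᶠ w in (F : Filter ℂ), r w ∈ Set.univ.pi fun _ => Metric.closedBall (0 : ℂ) R
      filter_upwards [hR.filter_mono hFn] with w hw i _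
      rw [mem_closedBall_zero_iff]
      refine hw _ ?_
      rw [hr]
      exact Multiset.mem_map_of_mem _ (Finset.mem_univ_val i))
  have hlim : Filter.Tendsto r F (nhds q) := hq
  have hlimi : ∀ i, Filter.Tendsto (fun w => r w i) F (nhds (q i)) :=
    fun i => tendsto_pi_nhds.1 hlim i
  -- Both sides are limits of `(P w).eval z` for each fixed `z`.
  have hP : P w₀ = Polynomial.C c * ∏ i, (Polynomial.X - Polynomial.C (q i)) := by
    refine Polynomial.funext fun z => ?_
    have h1 : Filter.Tendsto (fun w => (P w).eval z) F (nhds ((P w₀).eval z)) :=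
      (hcont z).mono_left hFn
    have h2 : Filter.Tendsto (fun w => (P w).eval z) F (nhds (c * ∏ i, (z - q i))) := by
      simp only [heval]
      exact (tendsto_finsetProd _ fun i _ => (hlimi i).const_sub z).const_mul c
    rw [tendsto_nhds_unique h1 h2]
    simp [Polynomial.eval_prod]
  have hroots : (P w₀).roots = Finset.univ.val.map q := by
    rw [hP, Polynomial.roots_C_mul _ hc,
      ← Polynomial.roots_multiset_prod_X_sub_C (Finset.univ.val.map q), Multiset.map_map]
    rfl
  have hall : ∀ᶠ w in (F : Filter ℂ), ∀ i, q i ∈ U → r w i ∈ U :=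
    Filter.eventually_all.2 fun i => by
      by_cases hi : q i ∈ U
      · filter_upwards [(hlimi i) (hU.mem_nhds hi)] with w hw _ using hw
      · exact Filter.Eventually.of_forall fun w h => absurd h hi
  obtain ⟨w, hw1, hw2⟩ := (hFs.and hall).exists
  refine hw1 ?_
  rw [hroots, hr w, hcard, hcard]
  exact Finset.card_le_card (Finset.monotone_filter_right _ fun i _ hi => hw2 i hi)

/-! ### Degree and zeros of `z^m (b(z) - w)` -/

theorem coeff_charPoly (b : ℂ[T;T⁻¹]) (m k : ℕ) (w : ℂ) (j : ℕ) :
    (charPoly b m k w).coeff j =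
      (if j < m + k + 1 then b.coeff ((j : ℤ) - m) else 0) - if j = m then w else 0 := by
  simp [charPoly, Polynomial.finsetSum_coeff, Polynomial.coeff_X_pow]

variable {b : ℂ[T;T⁻¹]} {m k : ℕ}

theorem natDegree_charPoly (hb : HasBand b m k) (hk : 1 ≤ k) (w : ℂ) :
    (charPoly b m k w).natDegree = m + k := by
  refine Polynomial.natDegree_eq_of_le_of_coeff_ne_zero ?_ ?_
  · rw [Polynomial.natDegree_le_iff_coeff_eq_zero]
    intro j hj
    rw [coeff_charPoly, if_neg (by omega), if_neg (by omega), sub_zero]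
  · rw [coeff_charPoly, if_pos (by omega), if_neg (by omega), sub_zero]
    simpa using hb.coeff_pos_ne_zero

theorem leadingCoeff_charPoly (hb : HasBand b m k) (hk : 1 ≤ k) (w : ℂ) :
    (charPoly b m k w).leadingCoeff = b.coeff k := by
  rw [Polynomial.leadingCoeff, natDegree_charPoly hb hk, coeff_charPoly, if_pos (by omega),
    if_neg (by omega), sub_zero]
  simp

theorem charPoly_ne_zero (hb : HasBand b m k) (hk : 1 ≤ k) (w : ℂ) : charPoly b m k w ≠ 0 := by
  rw [← Polynomial.leadingCoeff_ne_zero, leadingCoeff_charPoly hb hk]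
  exact hb.coeff_pos_ne_zero

theorem zero_notMem_zeros (hb : HasBand b m k) (hm : 1 ≤ m) (w : ℂ) : 0 ∉ zeros b m k w := by
  intro h
  have h1 := Polynomial.isRoot_of_mem_roots h
  rw [Polynomial.IsRoot, ← Polynomial.coeff_zero_eq_eval_zero, coeff_charPoly, if_pos (by omega),
    if_neg (by omega), sub_zero] at h1
  exact hb.coeff_neg_ne_zero (by simpa using h1)

theorem zeros_eq_add (b : ℂ[T;T⁻¹]) (m k : ℕ) (w : ℂ) :
    zeros b m k w = zerosIn b m k w + zerosExt b m k w + zerosUn b m k w := by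
  classical
  rw [zerosIn, zerosExt, zerosUn]
  refine Multiset.ext.2 fun z => ?_
  simp only [Multiset.count_add, Multiset.count_filter]
  rcases lt_trichotomy ‖z‖ 1 with h | h | h <;> simp [h, ne_of_lt, ne_of_gt, not_lt_of_gt]

theorem card_zerosIn_add_card_zerosExt_add_card_zerosUn (hb : HasBand b m k) (hk : 1 ≤ k)
    (w : ℂ) : Multiset.card (zerosIn b m k w) + Multiset.card (zerosExt b m k w) +
      Multiset.card (zerosUn b m k w) = m + k := by
  rw [← Multiset.card_add, ← Multiset.card_add, ← zeros_eq_add, zeros,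
    IsAlgClosed.card_roots_eq_natDegree, natDegree_charPoly hb hk]

theorem exists_norm_zeros_le (hb : HasBand b m k) (hk : 1 ≤ k) (w₀ : ℂ) :
    ∃ R : ℝ, ∀ᶠ w in nhds w₀, ∀ z ∈ zeros b m k w, ‖z‖ ≤ R := by
  -- `M` dominates every coefficient for `w` in the unit ball about `w₀`; the leading one is
  -- independent of `w`, so Cauchy's root bound is uniform.
  set M : ℝ := ∑ j ∈ Finset.range (m + k + 1), ‖b.coeff ((j : ℤ) - m)‖ + (‖w₀‖ + 1) with hM
  have hM0 : 0 ≤ M := by positivity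
  refine ⟨M / ‖b.coeff k‖ + 1, ?_⟩
  filter_upwards [Metric.ball_mem_nhds w₀ one_pos] with w hw z hz
  have hw' : ‖w‖ ≤ ‖w₀‖ + 1 := by
    have h1 := norm_le_norm_add_norm_sub' w w₀
    rw [Metric.mem_ball, dist_eq_norm] at hw
    linarith
  have h1 := (Polynomial.isRoot_of_mem_roots hz).norm_lt_cauchyBound (charPoly_ne_zero hb hk w)
  have h2 : ‖z‖ ≤ (charPoly b m k w).cauchyBound := by exact_mod_cast h1.le
  refine h2.trans ?_
  rw [Polynomial.cauchyBound, leadingCoeff_charPoly hb hk]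
  push_cast
  gcongr
  lift M to NNReal using hM0 with M'
  rw [NNReal.coe_le_coe]
  refine Finset.sup_le fun j hj => ?_
  rw [natDegree_charPoly hb hk, Finset.mem_range] at hj
  rw [← NNReal.coe_le_coe, coe_nnnorm, hM, coeff_charPoly, if_pos (by omega)]
  refine (norm_sub_le _ _).trans (add_le_add ?_ ?_)
  · exact Finset.single_le_sum (f := fun j : ℕ => ‖b.coeff ((j : ℤ) - m)‖)
      (fun _ _ => norm_nonneg _) (Finset.mem_range.2 (by omega))
  · split_ifs
    · exact hw'
    · rw [norm_zero]; positivity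

open Classical in
theorem eventually_card_filter_zeros_le (hb : HasBand b m k) (hk : 1 ≤ k) (w₀ : ℂ) {U : Set ℂ}
    (hU : IsOpen U) : ∀ᶠ w in nhds w₀, Multiset.card ((zeros b m k w₀).filter (· ∈ U)) ≤
      Multiset.card ((zeros b m k w).filter (· ∈ U)) := by
  obtain ⟨R, hR⟩ := exists_norm_zeros_le hb hk w₀
  refine eventually_card_filter_roots_le hb.coeff_pos_ne_zero (natDegree_charPoly hb hk)
    (leadingCoeff_charPoly hb hk) (fun z => ?_) hR hU
  simp only [charPoly, Polynomial.eval_sub, Polynomial.eval_mul, Polynomial.eval_C]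
  fun_prop

theorem eventually_card_zerosIn_le (hb : HasBand b m k) (hk : 1 ≤ k) (w₀ : ℂ) :
    ∀ᶠ w in nhds w₀, Multiset.card (zerosIn b m k w₀) ≤ Multiset.card (zerosIn b m k w) := by
  exact eventually_card_filter_zeros_le hb hk w₀ (U := {z | ‖z‖ < 1})
    (isOpen_lt continuous_norm continuous_const)

theorem eventually_card_zerosExt_le (hb : HasBand b m k) (hk : 1 ≤ k) (w₀ : ℂ) :
    ∀ᶠ w in nhds w₀, Multiset.card (zerosExt b m k w₀) ≤ Multiset.card (zerosExt b m k w) := by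
  exact eventually_card_filter_zeros_le hb hk w₀ (U := {z | 1 < ‖z‖})
    (isOpen_lt continuous_const continuous_norm)

theorem exists_pos_forall_mem_le {ι : Type*} (S : Multiset ι) (f : ι → ℝ) (hf : ∀ z ∈ S, 0 < f z) :
    ∃ δ > 0, ∀ z ∈ S, δ < f z := by
  induction S using Multiset.induction_on with
  | empty => exact ⟨1, one_pos, by simp⟩
  | cons a S ih =>
    obtain ⟨δ, h1, h2⟩ := ih fun z hz => hf z (Multiset.mem_cons_of_mem hz)
    have h3 := hf a (Multiset.mem_cons_self a S)
    refine ⟨min δ (f a / 2), by positivity, fun z hz => ?_⟩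
    rcases Multiset.mem_cons.1 hz with rfl | hz
    · exact (min_le_right _ _).trans_lt (by linarith)
    · exact (min_le_left _ _).trans_lt (h2 z hz)

open Classical in
/-- Near `w₀`, if there are no more zeros in `0 < f` than at `w₀`, then these zeros stay in
`δ < f`. -/
theorem exists_forall_zeros_lt (hb : HasBand b m k) (hk : 1 ≤ k) (w₀ : ℂ) {f : ℂ → ℝ}
    (hf : Continuous f) : ∃ δ > 0, ∀ᶠ w in nhds w₀,
      Multiset.card ((zeros b m k w).filter (0 < f ·)) ≤
        Multiset.card ((zeros b m k w₀).filter (0 < f ·)) →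
      ∀ z ∈ zeros b m k w, 0 < f z → δ < f z := by
  obtain ⟨δ, hδ, h1⟩ := exists_pos_forall_mem_le ((zeros b m k w₀).filter (0 < f ·)) f
    fun z hz => (Multiset.mem_filter.1 hz).2
  refine ⟨δ, hδ, ?_⟩
  have h2 : (zeros b m k w₀).filter (0 < f ·) = (zeros b m k w₀).filter (δ < f ·) :=
    Multiset.filter_congr fun z hz =>
      ⟨fun h => h1 z (Multiset.mem_filter.2 ⟨hz, h⟩), fun h => hδ.trans h⟩
  filter_upwards [eventually_card_filter_zeros_le hb hk w₀ (U := {z | δ < f z})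
    (isOpen_lt continuous_const hf)] with w hw hcard z hz hfz
  rw [← h2] at hw
  have h3 : (zeros b m k w).filter (δ < f ·) ≤ (zeros b m k w).filter (0 < f ·) :=
    Multiset.monotone_filter_right _ fun z h => hδ.trans h
  -- Semicontinuity supplies as many roots in `δ < f` as the assumption allows in `0 < f`, so the
  -- two multisets agree.
  have h4 := Multiset.eq_of_le_of_card_le h3 (hcard.trans hw)
  have h5 : z ∈ (zeros b m k w).filter (0 < f ·) := Multiset.mem_filter.2 ⟨hz, hfz⟩
  rw [← h4] at h5
  exact (Multiset.mem_filter.1 h5).2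

/-- If the number of zeros in the disk is locally bounded by its value at `w₀`, these zeros stay
away from the circle. -/
theorem exists_forall_zerosIn_le (hb : HasBand b m k) (hk : 1 ≤ k) (w₀ : ℂ) :
    ∃ δ > 0, ∀ᶠ w in nhds w₀,
      Multiset.card (zerosIn b m k w) ≤ Multiset.card (zerosIn b m k w₀) →
      ∀ z ∈ zerosIn b m k w, δ ≤ 1 - ‖z‖ := by
  classical
  obtain ⟨δ, hδ, h⟩ := exists_forall_zeros_lt hb hk w₀ (f := fun z => 1 - ‖z‖) (by fun_prop)
  refine ⟨δ, hδ, h.mono fun w hw hcard z hz => ?_⟩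
  simp only [sub_pos] at hw
  rw [zerosIn, zerosIn] at hcard
  rw [zerosIn, Multiset.mem_filter] at hz
  exact (hw (by convert hcard) z hz.1 hz.2).le

theorem exists_forall_zerosExt_le (hb : HasBand b m k) (hk : 1 ≤ k) (w₀ : ℂ) :
    ∃ δ > 0, ∀ᶠ w in nhds w₀,
      Multiset.card (zerosExt b m k w) ≤ Multiset.card (zerosExt b m k w₀) →
      ∀ z ∈ zerosExt b m k w, δ ≤ ‖z‖ - 1 := by
  classical
  obtain ⟨δ, hδ, h⟩ := exists_forall_zeros_lt hb hk w₀ (f := fun z => ‖z‖ - 1) (by fun_prop)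
  refine ⟨δ, hδ, h.mono fun w hw hcard z hz => ?_⟩
  simp only [sub_pos] at hw
  rw [zerosExt, zerosExt] at hcard
  rw [zerosExt, Multiset.mem_filter] at hz
  exact (hw (by convert hcard) z hz.1 hz.2).le

/-! ### The values of `b` on the circle belong to the spectrum -/

/-- The sum telescopes. For `‖t‖ = 1` this gives approximate eigenvectors: the vector has norm `√n`,
its image norm at most 2. -/
theorem mulOp_fourier_sub_geom_sum {t : ℂ} (ht : t ≠ 0) (n : ℕ) :
    mulOp (fourier 1 - algebraMap ℂ _ t)
      (∑ j ∈ Finset.range n, (t ^ j)⁻¹ • (fourierLp 2 (j : ℤ) : L2)) =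
      (t * (t ^ n)⁻¹) • fourierLp 2 (n : ℤ) - t • fourierLp 2 (0 : ℤ) := by
  induction n with
  | zero => simp
  | succ n ih =>
    rw [Finset.sum_range_succ, map_add, ih, map_smul, mulOp_sub, mulOp_fourierLp,
      Algebra.algebraMap_eq_smul_one, mulOp_smul, smul_apply, mulOp_one, add_comm (1 : ℤ),
      pow_succ, Nat.cast_succ, smul_sub, smul_smul,
      show t * (t ^ n * t)⁻¹ = (t ^ n)⁻¹ by field_simp, mul_comm t]
    abel

theorem norm_sq_geom_sum {t : ℂ} (ht : ‖t‖ = 1) (n : ℕ) :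
    ‖∑ j ∈ Finset.range n, (t ^ j)⁻¹ • (fourierLp 2 (j : ℤ) : L2)‖ ^ 2 = n := by
  have ho := (orthonormal_fourier (T := 1)).comp (fun j : ℕ => (j : ℤ)) Nat.cast_injective
  have h := ho.inner_sum (fun j => (t ^ j)⁻¹) (fun j => (t ^ j)⁻¹) (Finset.range n)
  rw [Finset.sum_congr rfl fun j _ => RCLike.conj_mul _] at h
  simp only [norm_inv, norm_pow, ht, one_pow, inv_one, Finset.sum_const, Finset.card_range] at h
  rw [inner_self_eq_norm_sq_to_K] at h
  simp only [Function.comp] at h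
  refine Complex.ofReal_injective ?_
  push_cast
  simpa using h

theorem fourier_sub_mem_multiplier (t : ℂ) :
    fourier 1 - algebraMap ℂ _ t ∈ multiplier H2 :=
  (multiplier H2).sub_mem (by exact_mod_cast fourier_mem_multiplier_H2 1)
    ((multiplier H2).algebraMap_mem t)

/-- Invertibility would give `T_{z - t}` a bounded left inverse `A`; testing it on the geometric
sums yields `n ≤ (2‖A‖)²` for every `n`. -/
theorem not_isUnit_toeplitzOp_mul {t : ℂ} (ht : ‖t‖ = 1) (φ : C(UnitAddCircle, ℂ)) :
    ¬ IsUnit (toeplitzOp (φ * (fourier 1 - algebraMap ℂ _ t))) := by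
  rw [toeplitzOp_mul_of_right (fourier_sub_mem_multiplier t)]
  intro h
  obtain ⟨S, hS⟩ := h.exists_left_inv
  rw [← mul_assoc] at hS
  set A := S * toeplitzOp φ
  have ht0 : t ≠ 0 := fun h => by simp [h] at ht
  have key : ∀ n : ℕ, (n : ℝ) ≤ (‖A‖ * 2) ^ 2 := fun n => by
    set f : H2 := ⟨∑ j ∈ Finset.range n, (t ^ j)⁻¹ • (fourierLp 2 (j : ℤ) : L2),
      H2.sum_mem fun j _ => H2.smul_mem _ (fourierLp_mem_H2 j)⟩
    have h1 : A (toeplitzOp (fourier 1 - algebraMap ℂ _ t) f) = f := by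
      rw [← mul_apply_eq_comp, hS]; rfl
    have h2 : ‖toeplitzOp (fourier 1 - algebraMap ℂ _ t) f‖ ≤ 2 := by
      refine (norm_toeplitzOp_apply_le _ _).trans ?_
      rw [mulOp_fourier_sub_geom_sum ht0]
      refine (norm_sub_le _ _).trans ?_
      have ho := (orthonormal_fourier (T := 1)).1
      rw [norm_smul, norm_smul, ho, ho]
      simp [ht]
      norm_num
    have h3 : ‖f‖ ≤ ‖A‖ * 2 := by
      rw [← h1]
      exact (A.le_opNorm _).trans (by gcongr)
    rw [← norm_sq_geom_sum ht n]
    change ‖f‖ ^ 2 ≤ _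
    gcongr
  obtain ⟨n, hn⟩ := exists_nat_gt ((‖A‖ * 2) ^ 2)
  exact (key n).not_gt hn

theorem mem_resolventSet_iff (w : ℂ) : w ∈ resolventSet ℂ (toeplitz b) ↔
    IsUnit (toeplitzOp (symbol b - algebraMap ℂ _ w)) := by
  rw [toeplitzOp_sub_algebraMap, ← IsUnit.neg_iff, neg_sub]
  rfl

theorem fourier_eq_zpow (n : ℤ) (x : UnitAddCircle) :
    (fourier n x : ℂ) = (fourier 1 x : ℂ) ^ n := by
  rw [fourier_one, fourier_apply, AddCircle.toCircle_zsmul, Circle.coe_zpow]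

theorem fourier_one_ne_zero (x : UnitAddCircle) : (fourier 1 x : ℂ) ≠ 0 := by
  rw [fourier_one]; exact Circle.coe_ne_zero _

theorem symbol_sub_apply (hb : HasBand b m k) (w : ℂ) (x : UnitAddCircle) :
    (symbol b - algebraMap ℂ _ w) x =
      fourier (-(m : ℤ)) x * (charPoly b m k w).eval (fourier 1 x) := by
  have h0 := fourier_one_ne_zero x
  rw [eval_charPoly hb w h0, ← mul_assoc]
  have h1 : fourier (-(m : ℤ)) x * (fourier 1 x) ^ m = 1 := by
    rw [fourier_eq_zpow (-(m : ℤ)), zpow_neg, zpow_natCast, inv_mul_cancel₀ (pow_ne_zero _ h0)]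
  rw [h1, one_mul, fourier_one]
  rfl

theorem value_mem_spectrum (hb : HasBand b m k) {t : ℂ} (ht : ‖t‖ = 1) :
    value b t ∈ spectrum ℂ (toeplitz b) := by
  have ht0 : t ≠ 0 := fun h => by simp [h] at ht
  change ¬ value b t ∈ resolventSet ℂ (toeplitz b)
  rw [mem_resolventSet_iff]
  have h1 : (charPoly b m k (value b t)).IsRoot t := by
    rw [Polynomial.IsRoot, eval_charPoly hb _ ht0, sub_self, mul_zero]
  obtain ⟨Q, hQ⟩ := Polynomial.dvd_iff_isRoot.2 h1
  -- The root `t` of the characteristic polynomial lets `z - t` be split off as an analytic right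
  -- factor.
  have h2 : symbol b - algebraMap ℂ _ (value b t) =
      (fourier (-(m : ℤ)) * Polynomial.aeval (fourier 1) Q) *
        (fourier 1 - algebraMap ℂ _ t) := by
    ext x
    rw [symbol_sub_apply hb, hQ]
    simp [Polynomial.aeval_continuousMap_apply]
    ring
  rw [h2]
  exact not_isUnit_toeplitzOp_mul ht _

/-! ### Wiener–Hopf factorization -/

theorem toeplitzOp_mul_eq_one {φ ψ : C(UnitAddCircle, ℂ)} (hφ : φ ∈ multiplier H2)
    (hψ : ψ ∈ multiplier H2) (h : φ * ψ = 1) :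
    toeplitzOp φ * toeplitzOp ψ = 1 ∧ toeplitzOp ψ * toeplitzOp φ = 1 := by
  rw [← toeplitzOp_mul_of_right hψ, ← toeplitzOp_mul_of_right hφ, mul_comm ψ, h, toeplitzOp_one]
  exact ⟨rfl, rfl⟩

theorem toeplitzOp_mul_eq_one_of_orthogonal {φ ψ : C(UnitAddCircle, ℂ)}
    (hφ : φ ∈ multiplier H2ᗮ) (hψ : ψ ∈ multiplier H2ᗮ) (h : φ * ψ = 1) :
    toeplitzOp φ * toeplitzOp ψ = 1 ∧ toeplitzOp ψ * toeplitzOp φ = 1 := by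
  rw [← toeplitzOp_mul_of_left hψ, ← toeplitzOp_mul_of_left hφ, mul_comm ψ, h, toeplitzOp_one]
  exact ⟨rfl, rfl⟩

/-- The inverse is `T_{χ'} T_{φ'}`. Since `φ' χ'` is the inverse of the symbol, bounded by `1/d`,
either of `χ'`, `φ'` can be traded for the other pair's factor: `χ' = φ (φ' χ')` and `φ' = χ (φ'
χ')`. Hence only one pair needs quantitative control. -/
theorem norm_inverse_toeplitzOp_mul_le {φ χ φ' χ' : C(UnitAddCircle, ℂ)}
    (hφ : φ ∈ multiplier H2ᗮ) (hφ' : φ' ∈ multiplier H2ᗮ) (hφφ' : φ * φ' = 1)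
    (hχ : χ ∈ multiplier H2) (hχ' : χ' ∈ multiplier H2) (hχχ' : χ * χ' = 1)
    {d : ℝ} (hd : 0 < d) (hdle : ∀ x, d ≤ ‖(φ * χ) x‖) :
    ‖Ring.inverse (toeplitzOp (φ * χ))‖ ≤ ‖φ‖ * ‖φ'‖ / d ∧
      ‖Ring.inverse (toeplitzOp (φ * χ))‖ ≤ ‖χ‖ * ‖χ'‖ / d := by
  obtain ⟨h1, h2⟩ := toeplitzOp_mul_eq_one_of_orthogonal hφ hφ' hφφ'
  obtain ⟨h3, h4⟩ := toeplitzOp_mul_eq_one hχ hχ' hχχ'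
  have h5 : Ring.inverse (toeplitzOp (φ * χ)) = toeplitzOp χ' * toeplitzOp φ' := by
    rw [toeplitzOp_mul_of_left hφ]
    exact Ring.inverse_unit ((⟨_, _, h1, h2⟩ : (H2 →L[ℂ] H2)ˣ) * ⟨_, _, h3, h4⟩)
  have h6 : ‖Ring.inverse (toeplitzOp (φ * χ))‖ ≤ ‖χ'‖ * ‖φ'‖ := by
    rw [h5]
    refine (norm_mul_le (toeplitzOp χ') (toeplitzOp φ')).trans ?_
    gcongr <;> exact norm_toeplitzOp_le _
  have h7 : ‖φ' * χ'‖ ≤ d⁻¹ := by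
    rw [ContinuousMap.norm_le _ (inv_nonneg.2 hd.le)]
    intro x
    have h8 : (φ * χ) * (φ' * χ') = 1 := by rw [mul_mul_mul_comm, hφφ', hχχ', one_mul]
    have h9 := congrArg norm (DFunLike.congr_fun h8 x)
    rw [ContinuousMap.mul_apply, norm_mul, ContinuousMap.one_apply, norm_one] at h9
    rw [eq_inv_of_mul_eq_one_right h9]
    exact inv_anti₀ hd (hdle x)
  constructor
  · have h8 : χ' = φ * (φ' * χ') := by rw [← mul_assoc, hφφ', one_mul]
    have h9 : ‖χ'‖ ≤ ‖φ‖ * d⁻¹ := by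
      rw [h8]; exact (norm_mul_le _ _).trans (by gcongr)
    refine h6.trans ((mul_le_mul_of_nonneg_right h9 (norm_nonneg _)).trans_eq ?_)
    rw [div_eq_mul_inv]; ring
  · have h8 : φ' = χ * (φ' * χ') := by rw [mul_left_comm, hχχ', mul_one]
    have h9 : ‖φ'‖ ≤ ‖χ‖ * d⁻¹ := by
      rw [h8]; exact (norm_mul_le _ _).trans (by gcongr)
    refine h6.trans ((mul_le_mul_of_nonneg_left h9 (norm_nonneg _)).trans_eq ?_)
    rw [div_eq_mul_inv]; ring

theorem factor_apply (φ : C(UnitAddCircle, ℂ)) (S : Multiset ℂ) (x : UnitAddCircle) :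
    factor φ S x = (S.map fun ζ => 1 - ζ * φ x).prod := by
  induction S using Multiset.induction_on with
  | empty => simp [factor]
  | cons ζ S ih =>
    have hf : factor φ (ζ ::ₘ S) = (1 - ζ • φ) * factor φ S := by simp [factor]
    rw [hf, ContinuousMap.mul_apply, ih]
    simp

theorem prod_map_sub_eq {z : ℂ} (hz : z ≠ 0) (S : Multiset ℂ) :
    (S.map fun ζ => z - ζ).prod = z ^ Multiset.card S * (S.map fun ζ => 1 - ζ * z⁻¹).prod := by
  induction S using Multiset.induction_on with
  | empty => simp
  | cons ζ S ih =>
    rw [Multiset.map_cons, Multiset.prod_cons, ih, Multiset.map_cons, Multiset.prod_cons,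
      Multiset.card_cons, show z - ζ = z * (1 - ζ * z⁻¹) by field_simp]
    ring

theorem prod_map_sub_eq_of_zero_notMem (z : ℂ) {S : Multiset ℂ} (hS : 0 ∉ S) :
    (S.map fun ζ => z - ζ).prod =
      (S.map fun ζ => -ζ).prod * ((S.map fun ζ => ζ⁻¹).map fun ζ => 1 - ζ * z).prod := by
  rw [Multiset.map_map, ← Multiset.prod_map_mul]
  refine congrArg Multiset.prod (Multiset.map_congr rfl fun ζ hζ => ?_)
  have h : ζ ≠ 0 := fun h => hS (h ▸ hζ)
  simp only [Function.comp]
  field_simp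
  ring

/-- Write `z - ζ` as `z (1 - ζ z⁻¹)` for inner roots and as `-ζ (1 - ζ⁻¹ z)` for outer ones. The
extracted powers of `z` combine with `z^(-m)`, the constants with the leading coefficient into `κ`.
-/
theorem exists_symbol_sub_eq_factor (hb : HasBand b m k) (hm : 1 ≤ m) (hk : 1 ≤ k) {w : ℂ}
    (hw : zerosUn b m k w = 0) : ∃ κ : ℂ, κ ≠ 0 ∧ symbol b - algebraMap ℂ _ w =
      factor (fourier (-1)) (zerosIn b m k w) *
        (fourier ((Multiset.card (zerosIn b m k w) : ℤ) - m) *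
          (κ • factor (fourier 1) ((zerosExt b m k w).map fun ζ => ζ⁻¹))) := by
  have h0 : 0 ∉ zerosExt b m k w := fun h => zero_notMem_zeros hb hm w (Multiset.mem_of_mem_filter h)
  refine ⟨b.coeff k * ((zerosExt b m k w).map fun ζ => -ζ).prod,
    mul_ne_zero hb.coeff_pos_ne_zero ?_, ?_⟩
  · rw [Ne, Multiset.prod_eq_zero_iff, Multiset.mem_map]
    rintro ⟨ζ, h1, h2⟩
    rw [neg_eq_zero] at h2
    exact h0 (h2 ▸ h1)
  · ext x
    have hz := fourier_one_ne_zero x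
    have hr : (charPoly b m k w).roots = zerosIn b m k w + zerosExt b m k w := by
      rw [← add_zero (_ + _), ← hw]; exact zeros_eq_add b m k w
    have hinv : (fourier (-1) x : ℂ) = (fourier 1 x)⁻¹ := by
      rw [fourier_eq_zpow, zpow_neg_one]
    have hpow : fourier (-(m : ℤ)) x * (fourier 1 x) ^ Multiset.card (zerosIn b m k w) =
        fourier ((Multiset.card (zerosIn b m k w) : ℤ) - m) x := by
      rw [fourier_eq_zpow, fourier_eq_zpow (_ - _), ← zpow_natCast, ← zpow_add₀ hz]
      congr 1
      ring
    rw [symbol_sub_apply hb, (IsAlgClosed.splits _).eval_eq_prod_roots,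
      leadingCoeff_charPoly hb hk, hr, Multiset.map_add, Multiset.prod_add, prod_map_sub_eq hz,
      prod_map_sub_eq_of_zero_notMem _ h0, ContinuousMap.mul_apply, ContinuousMap.mul_apply,
      ContinuousMap.smul_apply, factor_apply, factor_apply, hinv, ← hpow, smul_eq_mul]
    ring

theorem norm_lt_one_of_mem_zerosIn {w z : ℂ} (hz : z ∈ zerosIn b m k w) : ‖z‖ < 1 := by
  rw [zerosIn, Multiset.mem_filter] at hz
  exact hz.2

theorem one_lt_norm_of_mem_zerosExt {w z : ℂ} (hz : z ∈ zerosExt b m k w) : 1 < ‖z‖ := by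
  rw [zerosExt, Multiset.mem_filter] at hz
  exact hz.2

theorem mem_zerosUn_iff (hb : HasBand b m k) (hk : 1 ≤ k) {w z : ℂ} :
    z ∈ zerosUn b m k w ↔ ‖z‖ = 1 ∧ value b z = w := by
  rw [zerosUn, Multiset.mem_filter, zeros, Polynomial.mem_roots (charPoly_ne_zero hb hk w),
    Polynomial.IsRoot, and_comm]
  refine and_congr_right fun hz => ?_
  have hz0 : z ≠ 0 := fun h => by simp [h] at hz
  rw [eval_charPoly hb w hz0, mul_eq_zero, or_iff_right (pow_ne_zero _ hz0), sub_eq_zero]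

theorem exists_inverse_factor_zerosIn (b : ℂ[T;T⁻¹]) (m k : ℕ) (w : ℂ) {s : ℝ} (hs : s < 1)
    (h : ∀ ζ ∈ zerosIn b m k w, ‖ζ‖ ≤ s) :
    factor (fourier (-1)) (zerosIn b m k w) ∈ multiplier H2ᗮ ∧
    ‖factor (fourier (-1)) (zerosIn b m k w)‖ ≤ 2 ^ Multiset.card (zerosIn b m k w) ∧
    ∃ ψ ∈ multiplier H2ᗮ, factor (fourier (-1)) (zerosIn b m k w) * ψ = 1 ∧
      ‖ψ‖ ≤ (1 - s)⁻¹ ^ Multiset.card (zerosIn b m k w) :=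
  exists_inverse_factor H2.isClosed_orthogonal
    (by exact_mod_cast fourier_neg_mem_multiplier_orthogonal 1) (fourier_norm _).le hs _ h

/-- Only the product of the two norms is estimated, because `κ` cancels in it and no bound on `κ` is
needed. -/
theorem exists_inverse_factor_zerosExt (b : ℂ[T;T⁻¹]) (m k : ℕ) (w : ℂ) {κ : ℂ} (hκ : κ ≠ 0)
    {s : ℝ} (hs : s < 1) (h : ∀ ζ ∈ zerosExt b m k w, ‖ζ⁻¹‖ ≤ s) :
    κ • factor (fourier 1) ((zerosExt b m k w).map fun ζ => ζ⁻¹) ∈ multiplier H2 ∧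
    ∃ ψ ∈ multiplier H2,
      κ • factor (fourier 1) ((zerosExt b m k w).map fun ζ => ζ⁻¹) * ψ = 1 ∧
      ‖κ • factor (fourier 1) ((zerosExt b m k w).map fun ζ => ζ⁻¹)‖ * ‖ψ‖ ≤
        (2 * (1 - s)⁻¹) ^ Multiset.card (zerosExt b m k w) := by
  obtain ⟨h1, h2, ψ, h3, h4, h5⟩ := exists_inverse_factor isClosed_H2
    (by exact_mod_cast fourier_mem_multiplier_H2 1 : fourier 1 ∈ multiplier H2)
    (fourier_norm _).le hs ((zerosExt b m k w).map fun ζ => ζ⁻¹) (by simpa using h)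
  rw [Multiset.card_map] at h2 h5
  refine ⟨(multiplier H2).smul_mem h1 κ, κ⁻¹ • ψ, (multiplier H2).smul_mem h3 _, ?_, ?_⟩
  · rw [smul_mul_smul_comm, h4, mul_inv_cancel₀ hκ, one_smul]
  · rw [norm_smul, norm_smul, norm_inv, mul_mul_mul_comm,
      mul_inv_cancel₀ (norm_ne_zero_iff.2 hκ), one_mul, mul_pow]
    gcongr

theorem zerosUn_eq_zero_of_mem_resolventSet (hb : HasBand b m k) (hk : 1 ≤ k) {w : ℂ}
    (hw : w ∈ resolventSet ℂ (toeplitz b)) : zerosUn b m k w = 0 := by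
  refine Multiset.eq_zero_of_forall_notMem fun z hz => ?_
  obtain ⟨h1, h2⟩ := (mem_zerosUn_iff hb hk).1 hz
  exact value_mem_spectrum hb h1 (h2 ▸ hw)

/-- Cancelling the invertible outer factors leaves `T_{z^n}` with `n = |Z_in(w)| - m`, which is
invertible only for `n = 0`. -/
theorem card_zerosIn_of_mem_resolventSet (hb : HasBand b m k) (hm : 1 ≤ m) (hk : 1 ≤ k) {w : ℂ}
    (hw : w ∈ resolventSet ℂ (toeplitz b)) : Multiset.card (zerosIn b m k w) = m := by
  obtain ⟨κ, hκ, hfac⟩ :=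
    exists_symbol_sub_eq_factor hb hm hk (zerosUn_eq_zero_of_mem_resolventSet hb hk hw)
  obtain ⟨δ, hδ, h1⟩ := exists_pos_forall_mem_le (zerosIn b m k w) (fun z => 1 - ‖z‖)
    fun z hz => sub_pos.2 (norm_lt_one_of_mem_zerosIn hz)
  obtain ⟨ε, hε, h2⟩ := exists_pos_forall_mem_le (zerosExt b m k w) (fun z => 1 - ‖z⁻¹‖)
    fun z hz => by
      rw [norm_inv]; exact sub_pos.2 (inv_lt_one_of_one_lt₀ (one_lt_norm_of_mem_zerosExt hz))
  obtain ⟨hφ, -, φ', hφ', hφφ', -⟩ := exists_inverse_factor_zerosIn b m k w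
    (s := 1 - δ) (by linarith) fun ζ hζ => by linarith [h1 ζ hζ]
  obtain ⟨hχ, χ', hχ', hχχ', -⟩ := exists_inverse_factor_zerosExt b m k w hκ
    (s := 1 - ε) (by linarith) fun ζ hζ => by linarith [h2 ζ hζ]
  obtain ⟨h3, h4⟩ := toeplitzOp_mul_eq_one_of_orthogonal hφ hφ' hφφ'
  obtain ⟨h5, h6⟩ := toeplitzOp_mul_eq_one hχ hχ' hχχ'
  rw [mem_resolventSet_iff, hfac, toeplitzOp_mul_of_left hφ, toeplitzOp_mul_of_right hχ] at hw
  have h7 := eq_zero_of_isUnit_toeplitzOp_fourier ((Units.isUnit_mul_units _ ⟨_, _, h5, h6⟩).1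
    ((Units.isUnit_units_mul ⟨_, _, h3, h4⟩ _).1 hw))
  omega

theorem card_zerosExt_of_mem_resolventSet (hb : HasBand b m k) (hm : 1 ≤ m) (hk : 1 ≤ k) {w : ℂ}
    (hw : w ∈ resolventSet ℂ (toeplitz b)) : Multiset.card (zerosExt b m k w) = k := by
  have h1 := card_zerosIn_add_card_zerosExt_add_card_zerosUn hb hk w
  rw [zerosUn_eq_zero_of_mem_resolventSet hb hk hw, card_zerosIn_of_mem_resolventSet hb hm hk hw,
    Multiset.card_zero] at h1
  omega

/-! ### Resolvent estimates -/

/-- The family not governed by `s` also needs a gap from the circle for its factor to be invertible,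
but that gap may depend on `w`: it does not enter the bound. -/
theorem norm_resolvent_le (hb : HasBand b m k) (hm : 1 ≤ m) (hk : 1 ≤ k) {w : ℂ}
    (hw : w ∈ resolventSet ℂ (toeplitz b)) {d : ℝ} (hd : 0 < d)
    (hdle : ∀ x, d ≤ ‖symbol b x - w‖) {s : ℝ} (hs : s < 1)
    (hsw : (∀ ζ ∈ zerosIn b m k w, ‖ζ‖ ≤ s) ∨ (∀ ζ ∈ zerosExt b m k w, ‖ζ⁻¹‖ ≤ s)) :
    ∃ n ≤ m + k, ‖Ring.inverse (toeplitz b - algebraMap ℂ (H2 →L[ℂ] H2) w)‖ ≤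
      (2 * (1 - s)⁻¹) ^ n / d := by
  have hm' := card_zerosIn_of_mem_resolventSet hb hm hk hw
  have hk' := card_zerosExt_of_mem_resolventSet hb hm hk hw
  obtain ⟨κ, hκ, hfac⟩ :=
    exists_symbol_sub_eq_factor hb hm hk (zerosUn_eq_zero_of_mem_resolventSet hb hk hw)
  obtain ⟨δ, hδ, h1⟩ := exists_pos_forall_mem_le (zerosIn b m k w) (fun z => 1 - ‖z‖)
    fun z hz => sub_pos.2 (norm_lt_one_of_mem_zerosIn hz)
  obtain ⟨ε, hε, h2⟩ := exists_pos_forall_mem_le (zerosExt b m k w) (fun z => 1 - ‖z⁻¹‖)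
    fun z hz => by
      rw [norm_inv]; exact sub_pos.2 (inv_lt_one_of_one_lt₀ (one_lt_norm_of_mem_zerosExt hz))
  have h0 : fourier ((m : ℤ) - m) = (1 : C(UnitAddCircle, ℂ)) := by
    ext x; rw [sub_self]; exact fourier_zero
  rw [hm', h0, one_mul] at hfac
  have hT : toeplitz b - algebraMap ℂ (H2 →L[ℂ] H2) w =
      toeplitzOp (symbol b - algebraMap ℂ _ w) := (toeplitzOp_sub_algebraMap _ _).symm
  rw [hT, hfac]
  have hdle' : ∀ x, d ≤ ‖(symbol b - algebraMap ℂ _ w) x‖ := hdle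
  rw [hfac] at hdle'
  rcases hsw with h | h
  · refine ⟨m, by omega, ?_⟩
    obtain ⟨hφ, h3, φ', hφ', hφφ', h4⟩ := exists_inverse_factor_zerosIn b m k w hs h
    obtain ⟨hχ, χ', hχ', hχχ', -⟩ := exists_inverse_factor_zerosExt b m k w hκ
      (s := 1 - ε) (by linarith) fun ζ hζ => by linarith [h2 ζ hζ]
    refine (norm_inverse_toeplitzOp_mul_le hφ hφ' hφφ' hχ hχ' hχχ' hd hdle').1.trans ?_
    rw [hm'] at h3 h4
    rw [mul_pow]
    gcongr
  · refine ⟨k, by omega, ?_⟩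
    obtain ⟨hφ, -, φ', hφ', hφφ', -⟩ := exists_inverse_factor_zerosIn b m k w
      (s := 1 - δ) (by linarith) fun ζ hζ => by linarith [h1 ζ hζ]
    obtain ⟨hχ, χ', hχ', hχχ', h3⟩ := exists_inverse_factor_zerosExt b m k w hκ hs h
    refine (norm_inverse_toeplitzOp_mul_le hφ hφ' hφφ' hχ hχ' hχχ' hd hdle').2.trans ?_
    rw [hk'] at h3
    gcongr

theorem symbol_apply_mem_spectrum (hb : HasBand b m k) (x : UnitAddCircle) :
    symbol b x ∈ spectrum ℂ (toeplitz b) :=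
  value_mem_spectrum hb (Circle.norm_coe (AddCircle.toCircle x))

theorem infDist_spectrum_pos (hb : HasBand b m k) {w : ℂ}
    (hw : w ∈ resolventSet ℂ (toeplitz b)) : 0 < Metric.infDist w (spectrum ℂ (toeplitz b)) := by
  have h1 : IsClosed (spectrum ℂ (toeplitz b)) :=
    isClosed_compl_iff.2 (spectrum.isOpen_resolventSet (𝕜 := ℂ) (A := H2 →L[ℂ] H2) (toeplitz b))
  have h2 : w ∉ spectrum ℂ (toeplitz b) := fun h => h hw
  exact (h1.notMem_iff_infDist_pos ⟨_, symbol_apply_mem_spectrum hb 0⟩).1 h2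

theorem infDist_spectrum_le (hb : HasBand b m k) (w : ℂ) (x : UnitAddCircle) :
    Metric.infDist w (spectrum ℂ (toeplitz b)) ≤ ‖symbol b x - w‖ := by
  rw [← dist_eq_norm, dist_comm]
  exact Metric.infDist_le_dist_of_mem (symbol_apply_mem_spectrum hb x)

theorem LocallyRegularAt.llrg (hb : HasBand b m k) (hm : 1 ≤ m) (hk : 1 ≤ k) {w₀ : ℂ}
    (h : LocallyRegularAt b m k w₀) : LLRG b w₀ := by
  obtain ⟨ε, hε, δ, hδ, h⟩ := h
  obtain ⟨s, hs0, hs, hsw⟩ : ∃ s : ℝ, 0 ≤ s ∧ s < 1 ∧ ∀ w ∈ localRegion b w₀ ε,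
      (∀ ζ ∈ zerosIn b m k w, ‖ζ‖ ≤ s) ∨ (∀ ζ ∈ zerosExt b m k w, ‖ζ⁻¹‖ ≤ s) := by
    rcases h with h | h
    -- The maximum is needed because `δ` may exceed 1 when `Z_in` is vacuous on the region.
    · exact ⟨max 0 (1 - δ), le_max_left _ _, max_lt one_pos (by linarith), fun w hw =>
        Or.inl fun ζ hζ => le_max_of_le_right (by linarith [h w hw ζ hζ])⟩
    · refine ⟨(1 + δ)⁻¹, by positivity, inv_lt_one_of_one_lt₀ (by linarith), fun w hw =>
        Or.inr fun ζ hζ => ?_⟩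
      rw [norm_inv]
      exact inv_anti₀ (by linarith) (by linarith [h w hw ζ hζ])
  -- This allows the exponent `n ≤ m + k` to be replaced by `m + k`, independently of `w`.
  have hs1 : 1 ≤ 2 * (1 - s)⁻¹ := by
    have := one_le_inv_iff₀.2 ⟨sub_pos.2 hs, by linarith⟩
    linarith
  refine ⟨(2 * (1 - s)⁻¹) ^ (m + k), by positivity, ε, hε, fun ε' _ hε' w hw => ?_⟩
  have hw' : w ∈ localRegion b w₀ ε := ⟨Metric.ball_subset_ball hε' hw.1, hw.2⟩
  have hd := infDist_spectrum_pos hb hw.2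
  obtain ⟨n, hn, h1⟩ := norm_resolvent_le hb hm hk hw.2 hd (infDist_spectrum_le hb w) hs (hsw w hw')
  exact h1.trans (div_le_div_of_nonneg_right (pow_le_pow_right₀ hs1 hn) hd.le)

/-! ### Local regularity -/

/-- At resolvent points the count is exactly `m`, so the cardinality condition in
`exists_forall_zerosIn_le` holds automatically there. -/
theorem locallyRegularAt_of_card_zerosIn (hb : HasBand b m k) (hm : 1 ≤ m) (hk : 1 ≤ k) {w₀ : ℂ}
    (h : Multiset.card (zerosIn b m k w₀) = m) : LocallyRegularAt b m k w₀ := by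
  obtain ⟨δ, hδ, h1⟩ := exists_forall_zerosIn_le hb hk w₀
  obtain ⟨ε, hε, h2⟩ := Metric.eventually_nhds_iff_ball.1 h1
  exact ⟨ε, hε, δ, hδ, Or.inl fun w hw =>
    h2 w hw.1 (by rw [h, card_zerosIn_of_mem_resolventSet hb hm hk hw.2])⟩

theorem locallyRegularAt_of_card_zerosExt (hb : HasBand b m k) (hm : 1 ≤ m) (hk : 1 ≤ k) {w₀ : ℂ}
    (h : Multiset.card (zerosExt b m k w₀) = k) : LocallyRegularAt b m k w₀ := by
  obtain ⟨δ, hδ, h1⟩ := exists_forall_zerosExt_le hb hk w₀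
  obtain ⟨ε, hε, h2⟩ := Metric.eventually_nhds_iff_ball.1 h1
  exact ⟨ε, hε, δ, hδ, Or.inr fun w hw =>
    h2 w hw.1 (by rw [h, card_zerosExt_of_mem_resolventSet hb hm hk hw.2])⟩

theorem card_zerosIn_or_card_zerosExt_of_card_zerosUn (hb : HasBand b m k) (hm : 1 ≤ m)
    (hk : 1 ≤ k) {w₀ : ℂ} (hfr : w₀ ∈ frontier (spectrum ℂ (toeplitz b)))
    (h : Multiset.card (zerosUn b m k w₀) = 1) :
    Multiset.card (zerosIn b m k w₀) = m ∨ Multiset.card (zerosExt b m k w₀) = k := by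
  rw [frontier_eq_closure_inter_closure] at hfr
  -- A boundary point is a limit of resolvent points; one close enough satisfies both semicontinuity
  -- inequalities.
  obtain ⟨w, hw, h1, h2⟩ := ((mem_closure_iff_frequently.1 hfr.2).and_eventually
    ((eventually_card_zerosIn_le hb hk w₀).and (eventually_card_zerosExt_le hb hk w₀))).exists
  have hw' : w ∈ resolventSet ℂ (toeplitz b) := not_not.1 hw
  rw [card_zerosIn_of_mem_resolventSet hb hm hk hw'] at h1
  rw [card_zerosExt_of_mem_resolventSet hb hm hk hw'] at h2
  have h3 := card_zerosIn_add_card_zerosExt_add_card_zerosUn hb hk w₀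
  omega

theorem eval_derivative_charPoly (hb : HasBand b m k) {t : ℂ} (ht : t ≠ 0)
    (hd : DifferentiableAt ℂ (value b) t) :
    (charPoly b m k (value b t)).derivative.eval t = t ^ m * deriv (value b) t := by
  have h1 : HasDerivAt (fun z => z ^ m * (value b z - value b t))
      (m * t ^ (m - 1) * (value b t - value b t) + t ^ m * deriv (value b) t) t :=
    (hasDerivAt_pow m t).mul (hd.hasDerivAt.sub_const _)
  rw [sub_self, mul_zero, zero_add] at h1
  refine ((charPoly b m k (value b t)).hasDerivAt t).unique (h1.congr_of_eventuallyEq ?_)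
  filter_upwards [isOpen_ne.mem_nhds ht] with z hz using eval_charPoly hb _ hz

/-- Uniqueness makes the count equal to the multiplicity of `t`, and a multiple root would force the
derivative of `b` to vanish at `t`. -/
theorem card_zerosUn_eq_one (hb : HasBand b m k) (hk : 1 ≤ k) {t : ℂ} (ht : ‖t‖ = 1)
    (huniq : ∀ z : ℂ, ‖z‖ = 1 → value b z = value b t → z = t) (hd : deriv (value b) t ≠ 0) :
    Multiset.card (zerosUn b m k (value b t)) = 1 := by
  classical
  have ht0 : t ≠ 0 := fun h => by simp [h] at ht
  have h1 : zerosUn b m k (value b t) =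
      Multiset.replicate (Multiset.card (zerosUn b m k (value b t))) t :=
    Multiset.eq_replicate_card.2 fun z hz => by
      obtain ⟨h2, h3⟩ := (mem_zerosUn_iff hb hk).1 hz
      exact huniq z h2 h3
  have h2 : (zerosUn b m k (value b t)).count t = 1 := by
    rw [zerosUn, Multiset.count_filter_of_pos (p := fun z => ‖z‖ = 1) ht, zeros,
      Polynomial.count_roots]
    have hne := charPoly_ne_zero hb hk (value b t)
    refine le_antisymm ?_ ?_
    · by_contra hcon
      have h3 := ((Polynomial.one_lt_rootMultiplicity_iff_isRoot hne).1 (not_le.1 hcon)).2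
      -- `deriv` defaults to 0 where a function is not differentiable, so `hd` already contains
      -- differentiability.
      rw [Polynomial.IsRoot,
        eval_derivative_charPoly hb ht0 (differentiableAt_of_deriv_ne_zero hd)] at h3
      exact mul_ne_zero (pow_ne_zero _ ht0) hd h3
    · rw [Nat.one_le_iff_ne_zero, ← Nat.pos_iff_ne_zero, Polynomial.rootMultiplicity_pos hne,
        Polynomial.IsRoot, eval_charPoly hb _ ht0, sub_self, mul_zero]
  rwa [h1, Multiset.count_replicate_self] at h2

end

end BandedToeplitz

theorem mainTheorem1 (b : LaurentPolynomial ℂ) (m k : ℕ) (hm : 1 ≤ m) (hk : 1 ≤ k)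
    (hb : BandedToeplitz.HasBand b m k)
    (t₀ w₀ : ℂ) (ht₀ : ‖t₀‖ = 1) (hw₀ : w₀ = BandedToeplitz.value b t₀)
    (hfr : w₀ ∈ frontier (spectrum ℂ (BandedToeplitz.toeplitz b))) :
    ((Multiset.card (BandedToeplitz.zerosUn b m k w₀) = 1 ∨
        Multiset.card (BandedToeplitz.zerosIn b m k w₀) = m ∨
        Multiset.card (BandedToeplitz.zerosExt b m k w₀) = k) →
      BandedToeplitz.LocallyRegularAt b m k w₀ ∧ BandedToeplitz.LLRG b w₀) ∧
    (((∀ t : ℂ, ‖t‖ = 1 → BandedToeplitz.value b t = w₀ → t = t₀) ∧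
        deriv (BandedToeplitz.value b) t₀ ≠ 0) →
      BandedToeplitz.LocallyRegularAt b m k w₀ ∧ BandedToeplitz.LLRG b w₀) := by
  have key : (Multiset.card (BandedToeplitz.zerosIn b m k w₀) = m ∨
      Multiset.card (BandedToeplitz.zerosExt b m k w₀) = k) →
      BandedToeplitz.LocallyRegularAt b m k w₀ ∧ BandedToeplitz.LLRG b w₀ := fun h =>
    have h1 := h.elim (BandedToeplitz.locallyRegularAt_of_card_zerosIn hb hm hk)
      (BandedToeplitz.locallyRegularAt_of_card_zerosExt hb hm hk)
    ⟨h1, h1.llrg hb hm hk⟩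
  have key' := fun h => key
    (BandedToeplitz.card_zerosIn_or_card_zerosExt_of_card_zerosUn hb hm hk hfr h)
  refine ⟨fun h => h.elim key' key, fun h => key' ?_⟩
  subst hw₀
  exact BandedToeplitz.card_zerosUn_eq_one hb hk ht₀ h.1 h.2
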